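/- Let $\mathbb{H}\cong\mathbb{R}^4$ be the quaternions, let $\mathbb{S}$ be the set of $I\in\mathbb{H}$ with zero real part and $|I|=1$, and let $m$ be Lebesgue measure on $\mathbb{R}^4$. A function $f:\mathbb{H}\to\mathbb{H}$ is entire slice regular if it is real differentiable and $\frac12\big(\frac{\partial}{\partial x}+I\frac{\partial}{\partial y}\big)f(x+Iy)=0$ for all $I\in\mathbb{S}$ and $x,y\in\mathbb{R}$. For $\alpha>0$ and $0<p<\infty$, the Fock space of the first kind $\mathcal{F}^p_\alpha(\mathbb{H})$ is the set of all entire slice regular $f$ with $$\|f\|_{p,\alpha}^p:=\Big(\frac{\alpha p}{2\pi}\Big)^2\int_{\mathbb{H}}|f(q)|^p\big(e^{-\alpha|q|^2/2}\big)^p\,dm(q)<\infty .$$ A quaternionic polynomial is a function $q\mapsto\sum_{k=0}^n q^k a_k$ with $n\in\mathbb{N}$ and $a_0,\dots,a_n\in\mathbb{H}$. Theorem. Let $\alpha>0$ and $0<p<\infty$. Every quaternionic polynomial belongs to $\mathcal{F}^p_\alpha(\mathbb{H})$, and for every $f\in\mathcal{F}^p_\alpha(\mathbb{H})$ there is a sequence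 of quaternionic polynomials $(p_n)_{n\in\mathbb{N}}$ with $\|p_n-f\|_{p,\alpha}\to0$ as $n\to\infty$. -/

import Mathlib

open scoped Quaternion ENNReal Topology
open MeasureTheory Filter

/-- The Borel σ-algebra of `ℍ`. With it, Mathlib's `volume` on the inner product space `ℍ` is
the Lebesgue measure of `ℝ⁴` (see `measurePreserving_linearIsometryEquivTuple`). -/
noncomputable instance Quaternion.instMeasurableSpaceBorel : MeasurableSpace ℍ := borel ℍ

instance Quaternion.instBorelSpace : BorelSpace ℍ := ⟨rfl⟩

namespace SliceFock

theorem measurePreserving_linearIsometryEquivTuple :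
    MeasurePreserving Quaternion.linearIsometryEquivTuple
      (volume : Measure ℍ) (volume : Measure (EuclideanSpace ℝ (Fin 4))) :=
  Quaternion.linearIsometryEquivTuple.measurePreserving

/-- The sphere `𝕊` of purely imaginary unit quaternions. -/
def imagSphere : Set ℍ := {I | I.re = 0 ∧ ‖I‖ = 1}

/-- The point `x + I y` of the slice `ℂ_I`. -/
noncomputable def slicePoint (I : ℍ) (x y : ℝ) : ℍ := (x : ℍ) + I * (y : ℍ)

/-- The operator `½ (∂/∂x + I ∂/∂y)` applied to the restriction of `f` to `ℂ_I`, at `x + I y`. -/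
noncomputable def sliceDbar (f : ℍ → ℍ) (I : ℍ) (x y : ℝ) : ℍ :=
  (1 / 2 : ℝ) • (deriv (fun t : ℝ => f (slicePoint I t y)) x
    + I * deriv (fun t : ℝ => f (slicePoint I x t)) y)

/-- Entire (left) slice regular functions. -/
def IsEntireSliceRegular (f : ℍ → ℍ) : Prop :=
  Differentiable ℝ f ∧ ∀ I ∈ imagSphere, ∀ x y : ℝ, sliceDbar f I x y = 0

/-- `(αp/2π)² ∫_ℍ |f(q)|^p (e^{-α|q|²/2})^p dm(q)`, with values in `[0, ∞]`. -/
noncomputable def fockNormPow (p α : ℝ) (f : ℍ → ℍ) : ℝ≥0∞ :=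
  ENNReal.ofReal ((α * p / (2 * Real.pi)) ^ 2) *
    ∫⁻ q : ℍ, ENNReal.ofReal (‖f q‖ ^ p * (Real.exp (-α * ‖q‖ ^ 2 / 2)) ^ p)

/-- The (quasi-)norm `‖f‖_{p,α}`, with values in `[0, ∞]`. -/
noncomputable def fockNorm (p α : ℝ) (f : ℍ → ℍ) : ℝ≥0∞ := fockNormPow p α f ^ (1 / p)

/-- The slice regular Fock space of the first kind. -/
def fockSpace (p α : ℝ) : Set (ℍ → ℍ) :=
  {f | IsEntireSliceRegular f ∧ fockNormPow p α f < ∞}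

/-- The functions `q ↦ ∑_{k ≤ n} q^k a_k`, with quaternionic coefficients on the right. -/
def quaternionicPolynomials : Set (ℍ → ℍ) :=
  {P | ∃ (n : ℕ) (a : ℕ → ℍ), ∀ q : ℍ, P q = ∑ k ∈ Finset.range (n + 1), q ^ k * a k}

end SliceFock

/-!
Let `f` lie in the Fock space and put `f_r q = f (r q)` for `r < 1`. A change of variables bounds
the limsup of `‖f_r‖` as `r → 1` by `‖f‖`, which together with pointwise convergence gives
`‖f_r - f‖ → 0`. It remains to approximate `f_r` by its Taylor polynomials.

In the coordinates `z ∈ ℂ`, `v ∈ ℂ` with `q = z + (Im z) v j`, Lebesgue measure on `ℍ` has density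
`(Im z)²`, so by Fubini some slice `F` of `f` has `|F|^p e^{-αp|z|²/2} (Im z)²` integrable. The
weight `(Im z)²` is no obstacle to pointwise bounds: on the circle `|w - c| = r` it equals
`|Q(w)|² / 4r²` for a quadratic polynomial `Q` with `|Q(c)| = r²`, and `|Q|² |F|^p` has the sub-mean
value property. Hence `|F(z)| ≤ C e^{α(|z|+1)²/2}`, and Cauchy's estimates show that the
coefficients `a_k`, which are the same on all slices, satisfy `|a_k| R^k ≤ C e^{βR²/2}` for every
`β > α`. For `β = α / s` with `r < s < 1` this dominates the terms of the Taylor series of `f_r` by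
a geometric series times `e^{αs|q|²/2}`, which has finite norm.
-/

namespace SliceFock

open Metric Real

theorem log_norm_le_circleAverage {f : ℂ → ℂ} {c : ℂ} {r : ℝ} (hr : 0 < r)
    (hf : AnalyticOnNhd ℂ f (closedBall c r)) (hc : f c ≠ 0) :
    log ‖f c‖ ≤ circleAverage (log ‖f ·‖) c r := by
  rw [← abs_of_pos hr] at hf
  rw [hf.circleAverage_log_norm hr.ne' hc]
  refine le_add_of_nonneg_left (finsum_nonneg fun u => ?_)
  by_cases hu : u ∈ closedBall c |r|
  · refine mul_nonneg (mod_cast MeromorphicOn.AnalyticOnNhd.divisor_nonneg hf u) ?_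
    rcases eq_or_ne u c with rfl | huc
    · simp
    rw [← div_eq_mul_inv]
    refine log_nonneg ((one_le_div₀ (norm_sub_pos_iff.2 huc.symm)).2 ?_)
    simpa [abs_of_pos hr, dist_comm, dist_eq_norm] using hu
  · simp [hu]

theorem eventually_codiscreteWithin_sphere_ne_zero {f : ℂ → ℂ} {c : ℂ} {r : ℝ} (hr : 0 ≤ r)
    (hf : AnalyticOnNhd ℂ f (closedBall c r)) (hc : f c ≠ 0) :
    ∀ᶠ z in codiscreteWithin (sphere c r), f z ≠ 0 :=
  codiscreteWithin_mono sphere_subset_closedBall <|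
    hf.preimage_zero_mem_codiscreteWithin hc (mem_closedBall_self hr)
      ((convex_closedBall c r).isConnected (nonempty_closedBall.2 hr))

theorem exp_circleAverage_le {u : ℂ → ℝ} {c : ℂ} {r : ℝ} (hu : CircleIntegrable u c r)
    (hexp : CircleIntegrable (fun z => exp (u z)) c r) :
    exp (circleAverage u c r) ≤ circleAverage (fun z => exp (u z)) c r := by
  simp only [circleAverage_eq_intervalAverage]
  have period_pos : (0 : ℝ) < 2 * π := two_pi_pos
  refine convexOn_exp.map_set_average_le continuous_exp.continuousOn isClosed_univ ?_ ?_
    (by simp) (intervalIntegrable_iff.1 hu) (intervalIntegrable_iff.1 hexp)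
  · simp [Set.uIoc_of_le period_pos.le, pi_pos]
  · simp [Set.uIoc_of_le period_pos.le, ENNReal.mul_eq_top]

theorem norm_rpow_mul_norm_rpow_le_circleAverage {f g : ℂ → ℂ} {c : ℂ} {r s t : ℝ} (hr : 0 < r)
    (hs : 0 < s) (ht : 0 < t) (hf : AnalyticOnNhd ℂ f (closedBall c r))
    (hg : AnalyticOnNhd ℂ g (closedBall c r)) :
    ‖f c‖ ^ s * ‖g c‖ ^ t ≤ circleAverage (fun z => ‖f z‖ ^ s * ‖g z‖ ^ t) c r := by
  have nonneg : 0 ≤ circleAverage (fun z => ‖f z‖ ^ s * ‖g z‖ ^ t) c r :=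
    circleAverage_nonneg_of_nonneg fun z _ => by positivity
  rcases eq_or_ne (f c) 0 with hfc | hfc
  · simpa [hfc, zero_rpow hs.ne'] using nonneg
  rcases eq_or_ne (g c) 0 with hgc | hgc
  · simpa [hgc, zero_rpow ht.ne'] using nonneg
  have rpow_mul_rpow_eq {z : ℂ} (hfz : f z ≠ 0) (hgz : g z ≠ 0) :
      ‖f z‖ ^ s * ‖g z‖ ^ t = exp (s * log ‖f z‖ + t * log ‖g z‖) := by
    rw [rpow_def_of_pos (norm_pos_iff.2 hfz), rpow_def_of_pos (norm_pos_iff.2 hgz), exp_add,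
      mul_comm s, mul_comm t]
  have ae_eq : (fun z => ‖f z‖ ^ s * ‖g z‖ ^ t) =ᶠ[codiscreteWithin (sphere c |r|)]
      fun z => exp (s * log ‖f z‖ + t * log ‖g z‖) := by
    rw [abs_of_pos hr]
    filter_upwards [eventually_codiscreteWithin_sphere_ne_zero hr.le hf hfc,
      eventually_codiscreteWithin_sphere_ne_zero hr.le hg hgc] with z using rpow_mul_rpow_eq
  have integrable_log {h : ℂ → ℂ} (hh : AnalyticOnNhd ℂ h (closedBall c r)) (a : ℝ) :
      CircleIntegrable (fun z => a • log ‖h z‖) c r :=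
    (MeromorphicOn.circleIntegrable_log_norm_of_nonneg
      (hh.mono sphere_subset_closedBall).meromorphicOn hr.le).const_fun_smul
  have integrable : CircleIntegrable (fun z => ‖f z‖ ^ s * ‖g z‖ ^ t) c r := by
    have hf' := hf.continuousOn.mono sphere_subset_closedBall
    have hg' := hg.continuousOn.mono sphere_subset_closedBall
    exact ContinuousOn.circleIntegrable hr.le <|
      (hf'.norm.rpow_const fun _ _ => .inr hs.le).mul (hg'.norm.rpow_const fun _ _ => .inr ht.le)
  calc ‖f c‖ ^ s * ‖g c‖ ^ t = exp (s * log ‖f c‖ + t * log ‖g c‖) := rpow_mul_rpow_eq hfc hgc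
    _ ≤ exp (s * circleAverage (log ‖f ·‖) c r + t * circleAverage (log ‖g ·‖) c r) := by
      gcongr <;> exact log_norm_le_circleAverage hr ‹_› ‹_›
    _ = exp (circleAverage (fun z => s * log ‖f z‖ + t * log ‖g z‖) c r) := by
      simp only [← smul_eq_mul, ← circleAverage_fun_smul]
      rw [circleAverage_fun_add (integrable_log hf s) (integrable_log hg t)]
    _ ≤ circleAverage (fun z => exp (s * log ‖f z‖ + t * log ‖g z‖)) c r :=
      exp_circleAverage_le ((integrable_log hf s).add (integrable_log hg t))
        (integrable.congr_codiscreteWithin ae_eq)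
    _ = circleAverage (fun z => ‖f z‖ ^ s * ‖g z‖ ^ t) c r :=
      (circleAverage_congr_codiscreteWithin ae_eq hr.ne').symm

section Subharmonic

variable {E : Type*} [NormedAddCommGroup E] [NormedSpace ℂ E]

-- On the circle `r² = (w - c) * conj (w - c)`, so the quadratic is `(w - c) * (w - conj w)` there.
theorem norm_sq_add_mul_sub_of_mem_sphere {c w : ℂ} {r : ℝ} (hw : w ∈ sphere c r) :
    ‖(w - c) ^ 2 + (c - star c) * (w - c) - r ^ 2‖ = 2 * r * |w.im| := by
  have hr : ‖w - c‖ = r := mem_sphere_iff_norm.1 hw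
  have factor : (w - c) ^ 2 + (c - star c) * (w - c) - r ^ 2 = (w - c) * (w - star w) := by
    rw [← hr, ← Complex.mul_conj', map_sub, starRingEnd_apply, starRingEnd_apply]
    ring
  rw [factor, norm_mul, hr, ← starRingEnd_apply, Complex.sub_conj]
  simp only [Complex.ofReal_mul, Complex.ofReal_ofNat, norm_mul, Complex.norm_ofNat,
    Complex.norm_real, norm_eq_abs, Complex.norm_I, mul_one]
  ring

theorem sq_mul_norm_rpow_le_circleAverage {F : ℂ → E} (hF : Differentiable ℂ F) {p : ℝ}
    (hp : 0 < p) (c : ℂ) {r : ℝ} (hr : 0 < r) :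
    (r / 2) ^ 2 * ‖F c‖ ^ p ≤ circleAverage (fun z => z.im ^ 2 * ‖F z‖ ^ p) c r := by
  obtain ⟨ℓ, hℓ, hℓF⟩ := exists_dual_vector'' ℂ (F c)
  set Q : ℂ → ℂ := fun w => (w - c) ^ 2 + (c - star c) * (w - c) - r ^ 2
  have norm_Q_c : ‖Q c‖ = r ^ 2 := by simp [Q]
  have hQ : AnalyticOnNhd ℂ Q (closedBall c r) := fun z _ => by fun_prop
  have hℓF' : Differentiable ℂ fun z => ℓ (F z) := by fun_prop
  have integrable (H : ℂ → ℝ) (hH : Continuous H) : CircleIntegrable H c r :=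
    hH.continuousOn.circleIntegrable hr.le
  have key := calc
    r ^ 4 * ‖F c‖ ^ p = ‖Q c‖ ^ (2 : ℝ) * ‖ℓ (F c)‖ ^ p := by
      simp [norm_Q_c, hℓF, ← pow_mul]
    _ ≤ circleAverage (fun z => ‖Q z‖ ^ (2 : ℝ) * ‖ℓ (F z)‖ ^ p) c r :=
      norm_rpow_mul_norm_rpow_le_circleAverage hr two_pos hp hQ fun z _ => hℓF'.analyticAt z
    _ ≤ circleAverage (fun z => (4 * r ^ 2) • (z.im ^ 2 * ‖F z‖ ^ p)) c r := by
      refine circleAverage_mono (integrable _ ?_) (integrable _ ?_) fun z hz => ?_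
      · have : Continuous fun z => ‖ℓ (F z)‖ := hℓF'.continuous.norm
        simp only [Q]
        fun_prop (disch := positivity)
      · have : Continuous fun z => ‖F z‖ := hF.continuous.norm
        fun_prop (disch := positivity)
      · rw [abs_of_pos hr] at hz
        have : ‖ℓ (F z)‖ ≤ ‖F z‖ := ℓ.le_of_opNorm_le_of_le hℓ le_rfl |>.trans_eq (one_mul _)
        calc ‖Q z‖ ^ (2 : ℝ) * ‖ℓ (F z)‖ ^ p ≤ (2 * r * |z.im|) ^ 2 * ‖F z‖ ^ p := by
              rw [norm_sq_add_mul_sub_of_mem_sphere hz, rpow_two]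
              gcongr
          _ = (4 * r ^ 2) • (z.im ^ 2 * ‖F z‖ ^ p) := by
              rw [mul_pow, sq_abs, smul_eq_mul]
              ring
    _ = 4 * r ^ 2 * circleAverage (fun z => z.im ^ 2 * ‖F z‖ ^ p) c r := circleAverage_fun_smul
  refine le_of_mul_le_mul_left ?_ (by positivity : 0 < 4 * r ^ 2)
  linarith

theorem ofReal_circleAverage_eq_lintegral {φ : ℂ → ℝ} (hφ : Continuous φ)
    (hφ₀ : ∀ z, 0 ≤ φ z) (c : ℂ) (r : ℝ) :
    ENNReal.ofReal (2 * π * circleAverage φ c r) =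
      ∫⁻ θ in Set.Ioo (-π) π, ENNReal.ofReal (φ (circleMap c r θ)) := by
  have hφc : Continuous fun θ => φ (circleMap c r θ) := hφ.comp (continuous_circleMap c r)
  have periodic : Function.Periodic (fun θ => φ (circleMap c r θ)) (2 * π) :=
    (periodic_circleMap c r).comp φ
  have shift := periodic.intervalIntegral_add_eq 0 (-π)
  rw [zero_add, show -π + 2 * π = π by ring] at shift
  rw [circleAverage_def, smul_eq_mul, mul_inv_cancel_left₀ two_pi_pos.ne', shift,
    intervalIntegral.integral_of_le (by linarith [pi_pos]), integral_Ioc_eq_integral_Ioo,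
    ofReal_integral_eq_lintegral_ofReal (hφc.integrableOn_Icc.mono_set Set.Ioo_subset_Icc_self)
      (.of_forall fun θ => hφ₀ _)]

theorem lintegral_ball_eq_lintegral_circleAverage {φ : ℂ → ℝ} (hφ : Continuous φ)
    (hφ₀ : ∀ z, 0 ≤ φ z) (c : ℂ) (R : ℝ) :
    ∫⁻ z in ball c R, ENNReal.ofReal (φ z) =
      ∫⁻ r in Set.Ioo 0 R, ENNReal.ofReal (r * (2 * π * circleAverage φ c r)) := by
  set ψ : ℂ → ℝ≥0∞ := (ball c R).indicator fun z => ENNReal.ofReal (φ z)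
  have hψ : Measurable ψ := (by fun_prop : Measurable fun z => ENNReal.ofReal (φ z)).indicator
    measurableSet_ball
  have circle_eq (r θ : ℝ) : c + Complex.polarCoord.symm (r, θ) = circleMap c r θ := by
    simp [Complex.polarCoord_symm_apply, circleMap, Complex.exp_mul_I]
  have hpolar : Measurable fun q : ℝ × ℝ => circleMap c q.1 q.2 := by
    simp only [circleMap]
    fun_prop
  have indicator_circle {r : ℝ} (hr : 0 < r) (θ : ℝ) : ψ (circleMap c r θ) =
      (Set.Iio R).indicator (fun _ => ENNReal.ofReal (φ (circleMap c r θ))) r := by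
    have : circleMap c r θ ∈ ball c R ↔ r < R := by simp [dist_eq_norm, abs_of_pos hr]
    classical simp only [ψ, Set.indicator_apply, this, Set.mem_Iio]
  calc ∫⁻ z in ball c R, ENNReal.ofReal (φ z) = ∫⁻ z, ψ (c + z) := by
        rw [lintegral_add_left_eq_self (μ := volume), lintegral_indicator measurableSet_ball]
    _ = ∫⁻ q in Set.Ioi 0 ×ˢ Set.Ioo (-π) π,
          ENNReal.ofReal q.1 * ψ (circleMap c q.1 q.2) := by
        simp only [← Complex.lintegral_comp_polarCoord_symm, circle_eq, polarCoord_target,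
          smul_eq_mul]
    _ = ∫⁻ r in Set.Ioi 0, ENNReal.ofReal r *
          ∫⁻ θ in Set.Ioo (-π) π, ψ (circleMap c r θ) := by
        rw [Measure.volume_eq_prod, setLIntegral_prod _ (by fun_prop)]
        simp only [lintegral_const_mul' _ _ ENNReal.ofReal_ne_top]
    _ = ∫⁻ r in Set.Ioi 0, (Set.Iio R).indicator
          (fun r => ENNReal.ofReal (r * (2 * π * circleAverage φ c r))) r := by
        refine setLIntegral_congr_fun measurableSet_Ioi fun r (hr : 0 < r) => ?_
        by_cases hrR : r < R
        · simp [indicator_circle hr, hrR, ENNReal.ofReal_mul hr.le,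
            ofReal_circleAverage_eq_lintegral hφ hφ₀]
        · simp [indicator_circle hr, hrR]
    _ = ∫⁻ r in Set.Ioo 0 R, ENNReal.ofReal (r * (2 * π * circleAverage φ c r)) := by
        rw [setLIntegral_indicator measurableSet_Iio, Set.Iio_inter_Ioi]

theorem pow_mul_norm_rpow_le_lintegral_ball {F : ℂ → E} (hF : Differentiable ℂ F) {p : ℝ}
    (hp : 0 < p) (c : ℂ) {R : ℝ} (hR : 0 ≤ R) :
    ENNReal.ofReal (π * R ^ 4 / 8 * ‖F c‖ ^ p) ≤
      ∫⁻ z in ball c R, ENNReal.ofReal (z.im ^ 2 * ‖F z‖ ^ p) := by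
  have hcont : Continuous fun z => z.im ^ 2 * ‖F z‖ ^ p := by
    have : Continuous fun z => ‖F z‖ := hF.continuous.norm
    fun_prop (disch := positivity)
  rw [lintegral_ball_eq_lintegral_circleAverage hcont fun z => by positivity]
  calc ENNReal.ofReal (π * R ^ 4 / 8 * ‖F c‖ ^ p)
      = ENNReal.ofReal (∫ r in 0..R, r ^ 3 * (π / 2 * ‖F c‖ ^ p)) := by
        rw [intervalIntegral.integral_mul_const, integral_pow]
        ring_nf
    _ = ∫⁻ r in Set.Ioo 0 R, ENNReal.ofReal (r ^ 3 * (π / 2 * ‖F c‖ ^ p)) := by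
        rw [intervalIntegral.integral_of_le hR, integral_Ioc_eq_integral_Ioo,
          ofReal_integral_eq_lintegral_ofReal]
        · exact (Continuous.integrableOn_Icc (by fun_prop)).mono_set Set.Ioo_subset_Icc_self
        · filter_upwards [ae_restrict_mem measurableSet_Ioo] with r hr
          have : 0 < r := hr.1
          positivity
    _ ≤ ∫⁻ r in Set.Ioo 0 R, ENNReal.ofReal
          (r * (2 * π * circleAverage (fun z => z.im ^ 2 * ‖F z‖ ^ p) c r)) := by
        refine setLIntegral_mono' measurableSet_Ioo fun r hr => ENNReal.ofReal_le_ofReal ?_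
        have hr₀ : 0 < r := hr.1
        calc r ^ 3 * (π / 2 * ‖F c‖ ^ p) = r * (2 * π * ((r / 2) ^ 2 * ‖F c‖ ^ p)) := by ring
          _ ≤ _ := by gcongr; exact sq_mul_norm_rpow_le_circleAverage hF hp c hr₀

theorem exists_norm_le_mul_exp {F : ℂ → E} (hF : Differentiable ℂ F) {p α : ℝ} (hp : 0 < p)
    (hα : 0 ≤ α) (hfin : ∫⁻ z : ℂ, ENNReal.ofReal
      (z.im ^ 2 * (‖F z‖ * exp (-α * ‖z‖ ^ 2 / 2)) ^ p) < ∞) :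
    ∃ C ≥ 0, ∀ z, ‖F z‖ ≤ C * exp (α * (‖z‖ + 1) ^ 2 / 2) := by
  set S := ∫⁻ z : ℂ, ENNReal.ofReal (z.im ^ 2 * (‖F z‖ * exp (-α * ‖z‖ ^ 2 / 2)) ^ p)
  refine ⟨(S.toReal / (π / 8)) ^ p⁻¹, by positivity, fun c => ?_⟩
  set ε := exp (-(α * (‖c‖ + 1) ^ 2 / 2))
  have key := calc
    ENNReal.ofReal (π / 8 * (‖F c‖ * ε) ^ p)
        = ENNReal.ofReal (ε ^ p) * ENNReal.ofReal (π * 1 ^ 4 / 8 * ‖F c‖ ^ p) := by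
      rw [← ENNReal.ofReal_mul (by positivity), mul_rpow (by positivity) (by positivity)]
      ring_nf
    _ ≤ ENNReal.ofReal (ε ^ p) * ∫⁻ z in ball c 1, ENNReal.ofReal (z.im ^ 2 * ‖F z‖ ^ p) := by
      gcongr
      exact pow_mul_norm_rpow_le_lintegral_ball hF hp c zero_le_one
    _ = ∫⁻ z in ball c 1, ENNReal.ofReal (z.im ^ 2 * (‖F z‖ * ε) ^ p) := by
      rw [← lintegral_const_mul' _ _ ENNReal.ofReal_ne_top]
      congr with z
      rw [← ENNReal.ofReal_mul (by positivity), mul_rpow (by positivity) (by positivity)]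
      ring_nf
    _ ≤ ∫⁻ z in ball c 1, ENNReal.ofReal
          (z.im ^ 2 * (‖F z‖ * exp (-α * ‖z‖ ^ 2 / 2)) ^ p) := by
      refine setLIntegral_mono' measurableSet_ball fun z hz => ?_
      have hz : ‖z‖ ≤ ‖c‖ + 1 := by
        linarith [norm_le_norm_add_norm_sub c z, mem_ball_iff_norm.1 hz, norm_sub_rev z c]
      simp only [ε, neg_mul, neg_div]
      gcongr
    _ ≤ S := setLIntegral_le_lintegral _ _
  have : (‖F c‖ * ε) ^ p ≤ S.toReal / (π / 8) := by
    rw [le_div_iff₀' (by positivity)]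
    exact (ENNReal.ofReal_le_iff_le_toReal hfin.ne).1 key
  rw [← div_le_iff₀ (exp_pos _), div_eq_mul_inv, ← exp_neg]
  exact (le_rpow_inv_iff_of_pos (by positivity) (by positivity) hp).2 this

end Subharmonic

theorem imagSphere_mul_self {I : ℍ} (hI : I ∈ imagSphere) : I * I = -1 := by
  have normSq_I : I * star I = 1 := by
    simp [Quaternion.self_mul_star, Quaternion.normSq_eq_norm_mul_self, hI.2]
  rwa [Quaternion.star_eq_neg.2 hI.1, mul_neg, neg_eq_iff_eq_neg] at normSq_I

/-- The embedding of `ℂ` onto the slice `ℂ_I`. -/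
noncomputable def sliceHom (I : imagSphere) : ℂ →ₐ[ℝ] ℍ :=
  Complex.liftAux (I : ℍ) (imagSphere_mul_self I.2)

theorem sliceHom_apply (I : imagSphere) (z : ℂ) : sliceHom I z = slicePoint I z.re z.im := by
  rw [sliceHom, Complex.liftAux_apply, slicePoint, Quaternion.mul_coe_eq_smul]
  rfl

theorem lintegral_comp_linearEquiv_lt_top {E F : Type*} [NormedAddCommGroup E] [NormedSpace ℝ E]
    [MeasurableSpace E] [BorelSpace E] [FiniteDimensional ℝ E] [NormedAddCommGroup F]
    [NormedSpace ℝ F] [MeasurableSpace F] [BorelSpace F] (μ : Measure E) [μ.IsAddHaarMeasure]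
    (ν : Measure F) [ν.IsAddHaarMeasure] (L : E ≃ₗ[ℝ] F) {G : F → ℝ≥0∞}
    (hG : ∫⁻ y, G y ∂ν < ∞) :
    ∫⁻ x, G (L x) ∂μ < ∞ := by
  have := L.finiteDimensional
  let e : E ≃L[ℝ] F := L.toContinuousLinearEquiv
  have := e.isAddHaarMeasure_map μ
  calc ∫⁻ x, G (L x) ∂μ = ∫⁻ y, G y ∂(μ.map e) :=
        (lintegral_map_equiv G e.toHomeomorph.toMeasurableEquiv).symm
    _ < ∞ := by
        rw [Measure.isAddLeftInvariant_eq_smul (μ.map e) ν, lintegral_smul_measure]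
        exact ENNReal.mul_lt_top ENNReal.coe_lt_top hG

theorem lintegral_comp_smul {E : Type*} [NormedAddCommGroup E] [NormedSpace ℝ E]
    [MeasurableSpace E] [BorelSpace E] [FiniteDimensional ℝ E] (μ : Measure E)
    [μ.IsAddHaarMeasure] {r : ℝ} (hr : r ≠ 0) (g : E → ℝ≥0∞) :
    ∫⁻ x, g (r • x) ∂μ = ENNReal.ofReal |(r ^ Module.finrank ℝ E)⁻¹| * ∫⁻ x, g x ∂μ := by
  rw [← smul_eq_mul, ← lintegral_smul_measure, ← Measure.map_addHaar_smul μ hr]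
  exact (lintegral_map_equiv g (Homeomorph.smulOfNeZero r hr).toMeasurableEquiv).symm

/-- The identification of `ℂ × ℂ` with `ℍ = ℂ ⊕ ℂ j`. -/
def cayleyDickson : (ℂ × ℂ) ≃ₗ[ℝ] ℍ where
  toFun z := ⟨z.1.re, z.1.im, z.2.re, z.2.im⟩
  invFun q := (⟨q.re, q.imI⟩, ⟨q.imJ, q.imK⟩)
  map_add' _ _ := rfl
  map_smul' _ _ := by ext <;> simp <;> rfl
  left_inv _ := rfl
  right_inv _ := rfl

theorem cayleyDickson_im_smul (z v : ℂ) :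
    cayleyDickson (z, z.im • v) = (z.re : ℍ) + z.im • cayleyDickson (Complex.I, v) := by
  have decomposition : (z, z.im • v) = z.re • ((1 : ℂ), (0 : ℂ)) + z.im • (Complex.I, v) := by
    simp
  rw [decomposition, map_add, map_smul, map_smul, ← mul_one (z.re : ℍ),
    Quaternion.coe_mul_eq_smul]
  rfl

/-- The dilation `x + iy ↦ x + ity` of the imaginary axis. -/
noncomputable def imScale {t : ℝ} (ht : t ≠ 0) : ℂ ≃ₗ[ℝ] ℂ where
  toFun z := ⟨z.re, t * z.im⟩
  invFun z := ⟨z.re, t⁻¹ * z.im⟩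
  map_add' _ _ := by apply Complex.ext <;> simp [mul_add]
  map_smul' _ _ := by apply Complex.ext <;> simp [mul_left_comm]
  left_inv _ := by simp [ht]
  right_inv _ := by simp [ht]

theorem exists_lintegral_im_sq_mul_cayleyDickson_lt_top {G : ℍ → ℝ≥0∞} (hG : Measurable G)
    (hfin : ∫⁻ q, G q < ∞) :
    ∃ v : ℂ, ∫⁻ z : ℂ, ENNReal.ofReal (z.im ^ 2) * G (cayleyDickson (z, z.im • v)) < ∞ := by
  have measurable_cayleyDickson : Measurable cayleyDickson :=
    (LinearMap.continuous_of_finiteDimensional cayleyDickson.toLinearMap).measurable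
  -- Substituting `w = z.im • v` costs exactly the Jacobian `z.im ^ 2`.
  have substitution (z : ℂ) :
      ∫⁻ v, ENNReal.ofReal (z.im ^ 2) * G (cayleyDickson (z, z.im • v)) ≤
        ∫⁻ w, G (cayleyDickson (z, w)) := by
    rcases eq_or_ne z.im 0 with h | h
    · simp [h]
    rw [lintegral_const_mul' _ _ ENNReal.ofReal_ne_top,
      lintegral_comp_smul volume h fun w => G (cayleyDickson (z, w)), ← mul_assoc,
      ← ENNReal.ofReal_mul (by positivity)]
    simp [h]
  have finite_double_integral : ∫⁻ v : ℂ, ∫⁻ z : ℂ,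
      ENNReal.ofReal (z.im ^ 2) * G (cayleyDickson (z, z.im • v)) < ∞ := calc
    _ = ∫⁻ z : ℂ, ∫⁻ v : ℂ, ENNReal.ofReal (z.im ^ 2) * G (cayleyDickson (z, z.im • v)) := by
      refine lintegral_lintegral_swap (Measurable.aemeasurable ?_)
      fun_prop
    _ ≤ ∫⁻ z : ℂ, ∫⁻ w, G (cayleyDickson (z, w)) := lintegral_mono substitution
    _ = ∫⁻ z : ℂ × ℂ, G (cayleyDickson z) ∂(volume.prod volume) := by
      rw [lintegral_prod _ (by fun_prop)]
    _ < ∞ := lintegral_comp_linearEquiv_lt_top _ _ _ hfin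
  refine (ae_lt_top ?_ finite_double_integral.ne).exists
  exact Measurable.lintegral_prod_right' (f := fun x : ℂ × ℂ =>
    ENNReal.ofReal (x.2.im ^ 2) * G (cayleyDickson (x.2, x.2.im • x.1))) (by fun_prop)

theorem exists_lintegral_im_sq_mul_slice_lt_top {G : ℍ → ℝ≥0∞} (hG : Measurable G)
    (hfin : ∫⁻ q, G q < ∞) :
    ∃ I : imagSphere, ∫⁻ z : ℂ, ENNReal.ofReal (z.im ^ 2) * G (sliceHom I z) < ∞ := by
  obtain ⟨v, hv⟩ := exists_lintegral_im_sq_mul_cayleyDickson_lt_top hG hfin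
  set J := cayleyDickson (Complex.I, v)
  have hJ : ‖J‖ ≠ 0 := norm_ne_zero_iff.2 fun h => one_ne_zero (congr_arg QuaternionAlgebra.imI h)
  let I : imagSphere := ⟨‖J‖⁻¹ • J, by
    rw [Quaternion.re_smul, show J.re = 0 from rfl, smul_zero], by simp [norm_smul, hJ]⟩
  have slice_eq (z : ℂ) :
      cayleyDickson ((imScale hJ).symm z, ((imScale hJ).symm z).im • v) = sliceHom I z := by
    rw [cayleyDickson_im_smul, sliceHom_apply, slicePoint, Quaternion.mul_coe_eq_smul, smul_smul,
      mul_comm z.im]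
    rfl
  have rescaled := lintegral_comp_linearEquiv_lt_top volume volume (imScale hJ).symm hv
  have im_sq (z : ℂ) : z.im ^ 2 = ‖J‖ ^ 2 * ((imScale hJ).symm z).im ^ 2 := by
    rw [← mul_pow]
    exact congr_arg (· ^ 2) (mul_inv_cancel_left₀ hJ z.im).symm
  refine ⟨I, ?_⟩
  calc ∫⁻ z : ℂ, ENNReal.ofReal (z.im ^ 2) * G (sliceHom I z)
      = ENNReal.ofReal (‖J‖ ^ 2) * ∫⁻ z : ℂ, ENNReal.ofReal (((imScale hJ).symm z).im ^ 2) *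
          G (cayleyDickson ((imScale hJ).symm z, ((imScale hJ).symm z).im • v)) := by
        rw [← lintegral_const_mul' _ _ ENNReal.ofReal_ne_top]
        refine lintegral_congr fun z => ?_
        rw [slice_eq, ← mul_assoc, ← ENNReal.ofReal_mul (by positivity), ← im_sq]
    _ < ∞ := ENNReal.mul_lt_top ENNReal.ofReal_lt_top rescaled

theorem imagSphere_nonempty : imagSphere.Nonempty := by
  refine ⟨((Complex.I : ℂ) : ℍ), by simp, ?_⟩
  rw [← sq_eq_sq₀ (norm_nonneg _) zero_le_one, sq, ← Quaternion.normSq_eq_norm_mul_self,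
    Quaternion.normSq_def']
  simp

theorem exists_sliceHom_eq (q : ℍ) : ∃ (I : imagSphere) (z : ℂ), sliceHom I z = q := by
  rcases eq_or_ne q.im 0 with im_eq_zero | im_ne_zero
  · refine ⟨⟨_, imagSphere_nonempty.some_mem⟩, q.re, ?_⟩
    simpa [sliceHom_apply, slicePoint, im_eq_zero] using Quaternion.re_add_im q
  · have norm_im_ne_zero : ‖q.im‖ ≠ 0 := norm_ne_zero_iff.2 im_ne_zero
    refine ⟨⟨‖q.im‖⁻¹ • q.im, by simp, by simp [norm_smul, norm_im_ne_zero]⟩, ⟨q.re, ‖q.im‖⟩, ?_⟩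
    rw [sliceHom_apply, slicePoint, Quaternion.mul_coe_eq_smul, smul_inv_smul₀ norm_im_ne_zero]
    exact Quaternion.re_add_im q

theorem sliceHom_I (I : imagSphere) : sliceHom I Complex.I = I :=
  Complex.liftAux_apply_I _ _

theorem norm_sliceHom (I : imagSphere) (z : ℂ) : ‖sliceHom I z‖ = ‖z‖ := by
  have orthogonal : inner ℝ (z.re : ℍ) (I * (z.im : ℍ)) = 0 := by
    simp [Quaternion.inner_def, I.2.1]
  rw [← sq_eq_sq₀ (norm_nonneg _) (norm_nonneg _), sliceHom_apply, slicePoint,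
    norm_add_sq_real, orthogonal, norm_mul, I.2.2, Complex.sq_norm, Complex.normSq_apply]
  simp [← sq]

/-- `ℍ` as a complex vector space, the imaginary unit acting by left multiplication by `I`. -/
noncomputable abbrev sliceNormedSpace (I : imagSphere) : NormedSpace ℂ ℍ :=
  { Module.compHom ℍ (sliceHom I).toRingHom with
    norm_smul_le := fun z q => by
      change ‖sliceHom I z * q‖ ≤ ‖z‖ * ‖q‖
      rw [norm_mul, norm_sliceHom] }

theorem isScalarTower_slice (I : imagSphere) :
    letI := sliceNormedSpace I
    IsScalarTower ℝ ℂ ℍ := by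
  let := sliceNormedSpace I
  refine ⟨fun x z q => ?_⟩
  change sliceHom I (x • z) * q = x • (sliceHom I z * q)
  rw [map_smul, smul_mul_assoc]

-- `differentiableAt_complex_iff_differentiableAt_real` does not apply to slices: its real structure
-- is the one induced by the complex structure, which on `ℍ` is not definitionally the usual one.
theorem exists_restrictScalars_eq_iff {E : Type*} [NormedAddCommGroup E] [NormedSpace ℝ E]
    [NormedSpace ℂ E] [IsScalarTower ℝ ℂ E] (L : ℂ →L[ℝ] E) :
    (∃ L' : ℂ →L[ℂ] E, L'.restrictScalars ℝ = L) ↔ L Complex.I = Complex.I • L 1 := by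
  constructor
  · rintro ⟨L', rfl⟩
    simp [← map_smul]
  · refine fun L_I => ⟨ContinuousLinearMap.toSpanSingleton ℂ (L 1), ?_⟩
    ext z
    have z_eq : z = z.re • (1 : ℂ) + z.im • Complex.I := by simp
    have L_z : L z = z • L 1 := by
      conv_lhs => rw [z_eq, map_add, map_smul, map_smul, L_I, ← smul_assoc]
      conv_rhs => rw [z_eq, add_smul, smul_assoc, one_smul]
    simp [L_z]

theorem sliceDbar_eq (I : imagSphere) {f : ℍ → ℍ} (hf : Differentiable ℝ f) (z : ℂ) :
    sliceDbar f I z.re z.im =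
      (1 / 2 : ℝ) • (fderiv ℝ (fun w => f (sliceHom I w)) z 1 +
        I * fderiv ℝ (fun w => f (sliceHom I w)) z Complex.I) := by
  have hasFDerivAt_slice : HasFDerivAt (fun w => f (sliceHom I w))
      (fderiv ℝ (fun w => f (sliceHom I w)) z) (z.re + z.im * Complex.I) := by
    rw [Complex.re_add_im]
    exact (hf.comp (sliceHom I).toLinearMap.toContinuousLinearMap.differentiable z).hasFDerivAt
  have horizontal : HasDerivAt (fun t : ℝ => (t : ℂ) + z.im * Complex.I) 1 z.re :=
    Complex.ofRealCLM.hasDerivAt.add_const _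
  have vertical : HasDerivAt (fun t : ℝ => (z.re : ℂ) + t * Complex.I) Complex.I z.im := by
    simpa using (Complex.ofRealCLM.hasDerivAt.mul_const Complex.I).const_add (z.re : ℂ)
  have deriv_re := (hasFDerivAt_slice.comp_hasDerivAt z.re horizontal).deriv
  have deriv_im := (hasFDerivAt_slice.comp_hasDerivAt z.im vertical).deriv
  rw [sliceDbar, ← deriv_re, ← deriv_im]
  simp [Function.comp_def, sliceHom_apply]

theorem differentiable_slice_iff (I : imagSphere) {f : ℍ → ℍ} (hf : Differentiable ℝ f) :
    letI := sliceNormedSpace I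
    Differentiable ℂ (fun z => f (sliceHom I z)) ↔ ∀ x y : ℝ, sliceDbar f I x y = 0 := by
  let := sliceNormedSpace I
  have := isScalarTower_slice I
  have differentiable_real : Differentiable ℝ fun z => f (sliceHom I z) :=
    hf.comp (sliceHom I).toLinearMap.toContinuousLinearMap.differentiable
  have cauchy_riemann (z : ℂ) :
      DifferentiableAt ℂ (fun z => f (sliceHom I z)) z ↔ sliceDbar f I z.re z.im = 0 := by
    rw [differentiableAt_iff_restrictScalars ℝ (differentiable_real z),
      exists_restrictScalars_eq_iff, sliceDbar_eq I hf, smul_eq_zero_iff_right (by norm_num)]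
    generalize fderiv ℝ (fun w => f (sliceHom I w)) z = D
    change D Complex.I = sliceHom I Complex.I * D 1 ↔ _
    have I_ne_zero : (I : ℍ) ≠ 0 := norm_ne_zero_iff.1 (by simp [I.2.2])
    rw [sliceHom_I, ← mul_right_inj' I_ne_zero, ← mul_assoc, imagSphere_mul_self I.2,
      neg_one_mul, eq_neg_iff_add_eq_zero, add_comm]
  exact ⟨fun h x y => (cauchy_riemann ⟨x, y⟩).1 (h ⟨x, y⟩),
    fun h z => (cauchy_riemann z).2 (h z.re z.im)⟩

theorem isEntireSliceRegular_iff {f : ℍ → ℍ} :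
    IsEntireSliceRegular f ↔ Differentiable ℝ f ∧ ∀ I : imagSphere,
      letI := sliceNormedSpace I
      Differentiable ℂ fun z => f (sliceHom I z) := by
  refine and_congr_right fun hf => ?_
  simp only [differentiable_slice_iff _ hf, Subtype.forall]

theorem isEntireSliceRegular_polynomial (n : ℕ) (a : ℕ → ℍ) :
    IsEntireSliceRegular fun q => ∑ k ∈ Finset.range n, q ^ k * a k := by
  refine isEntireSliceRegular_iff.2 ⟨by fun_prop, fun I => ?_⟩
  let := sliceNormedSpace I
  have slice_eq : (fun z : ℂ => ∑ k ∈ Finset.range n, sliceHom I z ^ k * a k) =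
      fun z => ∑ k ∈ Finset.range n, z ^ k • a k := by
    simp only [← map_pow]
    rfl
  rw [slice_eq]
  fun_prop

/-- The coefficients of the power series of a slice regular `f`, read off its restriction to the
real line, which lies in every slice. -/
noncomputable def sliceCoeff (f : ℍ → ℍ) (n : ℕ) : ℍ :=
  (n.factorial : ℝ)⁻¹ • iteratedDeriv n (fun x : ℝ => f (x : ℍ)) 0

theorem iteratedDeriv_comp_ofReal {E : Type*} [NormedAddCommGroup E] [NormedSpace ℝ E]
    [NormedSpace ℂ E] [IsScalarTower ℝ ℂ E] [CompleteSpace E] (n : ℕ) {F : ℂ → E}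
    (hF : Differentiable ℂ F) (x : ℝ) :
    iteratedDeriv n (fun t : ℝ => F t) x = iteratedDeriv n F x := by
  induction n generalizing F with
  | zero => simp
  | succ n ih =>
    have deriv_comp_ofReal : (deriv fun t : ℝ => F t) = fun t : ℝ => deriv F t := by
      funext t
      simpa [Function.comp_def] using
        ((hF t).hasDerivAt.scomp t Complex.ofRealCLM.hasDerivAt).deriv
    rw [iteratedDeriv_succ', iteratedDeriv_succ', deriv_comp_ofReal]
    exact ih hF.deriv

theorem iteratedDeriv_slice (I : imagSphere) {f : ℍ → ℍ} (hf : IsEntireSliceRegular f) (n : ℕ) :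
    letI := sliceNormedSpace I
    iteratedDeriv n (fun z : ℂ => f (sliceHom I z)) 0 = (n.factorial : ℝ) • sliceCoeff f n := by
  let := sliceNormedSpace I
  have := isScalarTower_slice I
  rw [sliceCoeff, smul_inv_smul₀ (by positivity), ← Complex.ofReal_zero,
    ← iteratedDeriv_comp_ofReal n ((isEntireSliceRegular_iff.1 hf).2 I)]
  simp

theorem hasSum_sliceCoeff {f : ℍ → ℍ} (hf : IsEntireSliceRegular f) (q : ℍ) :
    HasSum (fun n => q ^ n * sliceCoeff f n) (f q) := by
  obtain ⟨I, z, rfl⟩ := exists_sliceHom_eq q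
  let := sliceNormedSpace I
  have := isScalarTower_slice I
  have taylor := Complex.hasSum_taylorSeries_of_entire ((isEntireSliceRegular_iff.1 hf).2 I) 0 z
  have term_eq (n : ℕ) : sliceHom I z ^ n * sliceCoeff f n =
      (n.factorial : ℂ)⁻¹ • (z - 0) ^ n • iteratedDeriv n (fun w => f (sliceHom I w)) 0 := by
    have factorial_inv : (n.factorial : ℂ)⁻¹ = (n.factorial : ℝ)⁻¹ • (1 : ℂ) := by simp
    rw [iteratedDeriv_slice I hf, sub_zero, factorial_inv, smul_assoc, one_smul, smul_comm,
      inv_smul_smul₀ (by positivity), ← map_pow]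
    rfl
  simpa only [term_eq] using taylor

theorem sq_add_le_mul_sq {α β : ℝ} (hαβ : α < β) (c t : ℝ) :
    α * (t + c) ^ 2 ≤ β * t ^ 2 + α * β * c ^ 2 / (β - α) := by
  have hδ : 0 < β - α := sub_pos.2 hαβ
  have square : β * t ^ 2 + α * β * c ^ 2 / (β - α) - α * (t + c) ^ 2 =
      ((β - α) * t - α * c) ^ 2 / (β - α) := by
    field_simp
    ring
  rw [← sub_nonneg, square]
  positivity

theorem exists_norm_slice_le_mul_exp {p α : ℝ} (hp : 0 < p) (hα : 0 < α) {f : ℍ → ℍ}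
    (hf : f ∈ fockSpace p α) :
    ∃ I : imagSphere, ∃ C ≥ 0, ∀ z, ‖f (sliceHom I z)‖ ≤ C * exp (α * (‖z‖ + 1) ^ 2 / 2) := by
  have measurable_density : Measurable fun q : ℍ =>
      ENNReal.ofReal (‖f q‖ ^ p * exp (-α * ‖q‖ ^ 2 / 2) ^ p) := by
    have := hf.1.1.continuous
    fun_prop
  have lintegral_lt_top : ∫⁻ q, ENNReal.ofReal (‖f q‖ ^ p * exp (-α * ‖q‖ ^ 2 / 2) ^ p) < ∞ :=
    ENNReal.lt_top_of_mul_ne_top_right hf.2.ne (ENNReal.ofReal_pos.2 (by positivity)).ne'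
  obtain ⟨I, hI⟩ := exists_lintegral_im_sq_mul_slice_lt_top measurable_density lintegral_lt_top
  let := sliceNormedSpace I
  refine ⟨I, exists_norm_le_mul_exp ((isEntireSliceRegular_iff.1 hf.1).2 I) hp hα.le ?_⟩
  simpa only [mul_rpow (norm_nonneg _) (exp_nonneg _), ENNReal.ofReal_mul (sq_nonneg _),
    norm_sliceHom] using hI

theorem exists_norm_sliceCoeff_mul_pow_le {p α β : ℝ} (hp : 0 < p) (hα : 0 < α) (hαβ : α < β)
    {f : ℍ → ℍ} (hf : f ∈ fockSpace p α) :
    ∃ C ≥ 0, ∀ (n : ℕ) (R : ℝ), 0 ≤ R →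
      ‖sliceCoeff f n‖ * R ^ n ≤ C * exp (β * R ^ 2 / 2) := by
  obtain ⟨I, C, hC, growth⟩ := exists_norm_slice_le_mul_exp hp hα hf
  let := sliceNormedSpace I
  have slice_differentiable := (isEntireSliceRegular_iff.1 hf.1).2 I
  refine ⟨C * exp (2 * α * β / (β - α)), by positivity, fun n R hR => ?_⟩
  -- Cauchy's estimate on a circle of radius `R + 1`, which is never `0`.
  have cauchy : ‖iteratedDeriv n (fun z : ℂ => f (sliceHom I z)) 0‖ ≤
      n.factorial * (C * exp (α * (R + 2) ^ 2 / 2)) / (R + 1) ^ n := by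
    refine Complex.norm_iteratedDeriv_le_of_forall_mem_sphere_norm_le n (by positivity)
      slice_differentiable.diffContOnCl fun z hz => (growth z).trans_eq ?_
    rw [mem_sphere_zero_iff_norm.1 hz]
    ring_nf
  rw [iteratedDeriv_slice I hf.1, norm_smul, norm_natCast, mul_div_assoc,
    mul_le_mul_iff_right₀ (by positivity), le_div_iff₀ (by positivity)] at cauchy
  calc ‖sliceCoeff f n‖ * R ^ n ≤ ‖sliceCoeff f n‖ * (R + 1) ^ n := by gcongr; linarith
    _ ≤ C * exp (α * (R + 2) ^ 2 / 2) := cauchy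
    _ ≤ C * exp (2 * α * β / (β - α) + β * R ^ 2 / 2) := by
        have := sq_add_le_mul_sq hαβ 2 R
        gcongr
        linear_combination this / 2
    _ = C * exp (2 * α * β / (β - α)) * exp (β * R ^ 2 / 2) := by rw [exp_add, ← mul_assoc]

theorem tendsto_lintegral_zero_of_le_of_lintegral_le {X ι : Type*} [MeasurableSpace X]
    {μ : Measure X} {l : Filter ι} [l.IsCountablyGenerated] {d b : ι → X → ℝ≥0∞} {B : X → ℝ≥0∞}
    {t : ι → ℝ≥0∞} (hd : ∀ i, Measurable (d i)) (hb : ∀ i, Measurable (b i))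
    (hB : Measurable B) (hB_fin : ∫⁻ x, B x ∂μ ≠ ∞) (hdb : ∀ i x, d i x ≤ b i x)
    (hd_lim : ∀ᵐ x ∂μ, Tendsto (d · x) l (𝓝 0)) (hb_lim : ∀ᵐ x ∂μ, Tendsto (b · x) l (𝓝 (B x)))
    (hbt : ∀ᶠ i in l, ∫⁻ x, b i x ∂μ ≤ t i) (ht : Tendsto t l (𝓝 (∫⁻ x, B x ∂μ))) :
    Tendsto (fun i => ∫⁻ x, d i x ∂μ) l (𝓝 0) := by
  have min_fin (g : X → ℝ≥0∞) : ∫⁻ x, min (g x) (B x) ∂μ ≠ ∞ :=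
    ne_top_of_le_ne_top hB_fin (lintegral_mono fun x => min_le_right _ _)
  have tendsto_min_d : Tendsto (fun i => ∫⁻ x, min (d i x) (B x) ∂μ) l (𝓝 0) := by
    rw [← lintegral_zero (μ := μ)]
    refine tendsto_lintegral_filter_of_dominated_convergence B
      (.of_forall fun i => (hd i).min hB) (.of_forall fun i => .of_forall fun x => min_le_right _ _)
      hB_fin ?_
    filter_upwards [hd_lim] with x hx
    simpa using hx.min (tendsto_const_nhds (x := B x))
  have tendsto_min_b : Tendsto (fun i => ∫⁻ x, min (b i x) (B x) ∂μ) l (𝓝 (∫⁻ x, B x ∂μ)) := by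
    refine tendsto_lintegral_filter_of_dominated_convergence B
      (.of_forall fun i => (hb i).min hB) (.of_forall fun i => .of_forall fun x => min_le_right _ _)
      hB_fin ?_
    filter_upwards [hb_lim] with x hx
    simpa using hx.min (tendsto_const_nhds (x := B x))
  have split (i : ι) (x : X) : d i x ≤ min (d i x) (B x) + (b i x - min (b i x) (B x)) := by
    rcases le_total (d i x) (B x) with h | h
    · rw [min_eq_left h]
      exact le_self_add
    · rw [min_eq_right h, min_eq_right (h.trans (hdb i x)),
        add_tsub_cancel_of_le (h.trans (hdb i x))]
      exact hdb i x
  have bound {i : ι} (hi : ∫⁻ x, b i x ∂μ ≤ t i) : ∫⁻ x, d i x ∂μ ≤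
      ∫⁻ x, min (d i x) (B x) ∂μ + (t i - ∫⁻ x, min (b i x) (B x) ∂μ) := calc
    _ ≤ ∫⁻ x, min (d i x) (B x) + (b i x - min (b i x) (B x)) ∂μ := lintegral_mono (split i)
    _ = ∫⁻ x, min (d i x) (B x) ∂μ + (∫⁻ x, b i x ∂μ - ∫⁻ x, min (b i x) (B x) ∂μ) := by
      rw [lintegral_add_left ((hd i).min hB), lintegral_sub ((hb i).min hB) (min_fin _)
        (.of_forall fun x => min_le_left _ _)]
    _ ≤ _ := by gcongr
  refine tendsto_of_tendsto_of_tendsto_of_le_of_le' tendsto_const_nhds ?_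
    (.of_forall fun _ => zero_le) (hbt.mono fun _ => bound)
  simpa using tendsto_min_d.add (ENNReal.Tendsto.sub ht tendsto_min_b (.inl hB_fin))

theorem enorm_sub_rpow_le {E : Type*} [SeminormedAddCommGroup E] {p : ℝ} (hp : 0 ≤ p) (x y : E) :
    ‖x - y‖ₑ ^ p ≤ ENNReal.LpAddConst (ENNReal.ofReal p)⁻¹ * (‖x‖ₑ ^ p + ‖y‖ₑ ^ p) :=
  (ENNReal.rpow_le_rpow enorm_sub_le hp).trans (ENNReal.rpow_add_le_mul_rpow_add_rpow' _ _ hp)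

theorem tendsto_lintegral_enorm_sub_rpow {X ι E : Type*} [MeasurableSpace X] {μ : Measure X}
    {l : Filter ι} [l.IsCountablyGenerated] [NormedAddCommGroup E] {p : ℝ} (hp : 0 < p)
    {u : ι → X → E} {f : X → E} {t : ι → ℝ≥0∞} (hu : ∀ i, StronglyMeasurable (u i))
    (hf : StronglyMeasurable f) (hf_fin : ∫⁻ x, ‖f x‖ₑ ^ p ∂μ ≠ ∞)
    (hu_lim : ∀ᵐ x ∂μ, Tendsto (u · x) l (𝓝 (f x)))
    (hut : ∀ᶠ i in l, ∫⁻ x, ‖u i x‖ₑ ^ p ∂μ ≤ t i) (ht : Tendsto t l (𝓝 (∫⁻ x, ‖f x‖ₑ ^ p ∂μ))) :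
    Tendsto (fun i => ∫⁻ x, ‖u i x - f x‖ₑ ^ p ∂μ) l (𝓝 0) := by
  set K := ENNReal.LpAddConst (ENNReal.ofReal p)⁻¹
  have hK : K ≠ ∞ := (ENNReal.LpAddConst_lt_top _).ne
  have lintegral_majorant (g : X → E) :
      ∫⁻ x, K * (‖g x‖ₑ ^ p + ‖f x‖ₑ ^ p) ∂μ =
        K * (∫⁻ x, ‖g x‖ₑ ^ p ∂μ + ∫⁻ x, ‖f x‖ₑ ^ p ∂μ) := by
    rw [lintegral_const_mul' _ _ hK, lintegral_add_right _ (hf.enorm.pow_const p)]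
  refine tendsto_lintegral_zero_of_le_of_lintegral_le
    (b := fun i x => K * (‖u i x‖ₑ ^ p + ‖f x‖ₑ ^ p)) (B := fun x => K * (‖f x‖ₑ ^ p + ‖f x‖ₑ ^ p))
    (t := fun i => K * (t i + ∫⁻ x, ‖f x‖ₑ ^ p ∂μ)) ?_ ?_ ?_ ?_
    (fun i x => enorm_sub_rpow_le hp.le _ _) ?_ ?_ ?_ ?_
  · exact fun i => ((hu i).sub hf).enorm.pow_const p
  · exact fun i => (((hu i).enorm.pow_const p).add (hf.enorm.pow_const p)).const_mul K
  · exact ((hf.enorm.pow_const p).add (hf.enorm.pow_const p)).const_mul K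
  · rw [lintegral_majorant]
    finiteness
  · filter_upwards [hu_lim] with x hx
    simpa [hp] using (hx.sub_const (f x)).enorm.ennrpow_const p
  · filter_upwards [hu_lim] with x hx
    exact ENNReal.Tendsto.const_mul ((hx.enorm.ennrpow_const p).add tendsto_const_nhds) (.inr hK)
  · filter_upwards [hut] with i hi
    rw [lintegral_majorant]
    gcongr
  · rw [lintegral_majorant]
    exact ENNReal.Tendsto.const_mul (ht.add tendsto_const_nhds) (.inr hK)

theorem fockNormPow_le_of_norm_le {p α C : ℝ} (hp : 0 ≤ p) (hC : 0 ≤ C) {f g : ℍ → ℍ}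
    (hfg : ∀ q, ‖f q‖ ≤ C * ‖g q‖) :
    fockNormPow p α f ≤ ENNReal.ofReal (C ^ p) * fockNormPow p α g := by
  rw [fockNormPow, fockNormPow, mul_left_comm,
    ← lintegral_const_mul' (.ofReal (C ^ p)) _ ENNReal.ofReal_ne_top]
  refine mul_le_mul_right (lintegral_mono fun q => ?_) _
  rw [← ENNReal.ofReal_mul (by positivity), ← mul_assoc, ← mul_rpow hC (norm_nonneg _)]
  gcongr
  exact hfg q

theorem fockNormPow_exp_lt_top {p α β : ℝ} (hp : 0 < p) (hβα : β < α) :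
    fockNormPow p α (fun q => (exp (β * ‖q‖ ^ 2 / 2) : ℝ)) < ∞ := by
  set b := p * (α - β) / 2
  have hb : 0 < b := by
    have := sub_pos.2 hβα
    positivity
  have density_eq (q : ℍ) :
      ‖((exp (β * ‖q‖ ^ 2 / 2) : ℝ) : ℍ)‖ ^ p * exp (-α * ‖q‖ ^ 2 / 2) ^ p =
        exp (-b * ‖q‖ ^ 2) := by
    rw [Quaternion.norm_coe, norm_of_nonneg (exp_nonneg _), ← exp_mul, ← exp_mul, ← exp_add]
    congr 1
    ring
  have integrable_gaussian : Integrable fun q : ℍ => exp (-b * ‖q‖ ^ 2) := by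
    refine (GaussianFourier.integrable_cexp_neg_mul_sq_norm_add (V := ℍ) (b := b)
      (by simpa using hb) 0 0).norm.congr (.of_forall fun q => ?_)
    simp [Complex.norm_exp, ← Complex.ofReal_pow]
  rw [fockNormPow]
  simp only [density_eq]
  exact ENNReal.mul_lt_top ENNReal.ofReal_lt_top integrable_gaussian.lintegral_lt_top

theorem exists_pow_le_mul_exp_sq {β : ℝ} (hβ : 0 < β) (k : ℕ) :
    ∃ C ≥ 0, ∀ t ≥ 0, t ^ k ≤ C * exp (β * t ^ 2 / 2) := by
  refine ⟨k.factorial * exp (1 / (2 * β)), by positivity, fun t ht => ?_⟩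
  have le_add_sq : t ≤ 1 / (2 * β) + β * t ^ 2 / 2 := by
    have : 1 / (2 * β) + β * t ^ 2 / 2 - t = (β * t - 1) ^ 2 / (2 * β) := by
      field_simp
      ring
    rw [← sub_nonneg, this]
    positivity
  calc t ^ k ≤ k.factorial * exp t := by
        rw [mul_comm, ← div_le_iff₀ (by positivity)]
        exact pow_div_factorial_le_exp t ht k
    _ ≤ k.factorial * exp (1 / (2 * β) + β * t ^ 2 / 2) := by gcongr
    _ = k.factorial * exp (1 / (2 * β)) * exp (β * t ^ 2 / 2) := by rw [exp_add, mul_assoc]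

theorem quaternionicPolynomials_subset_fockSpace {p α : ℝ} (hp : 0 < p) (hα : 0 < α) :
    quaternionicPolynomials ⊆ fockSpace p α := by
  rintro P ⟨n, a, hP⟩
  obtain rfl : P = fun q => ∑ k ∈ Finset.range (n + 1), q ^ k * a k := funext hP
  refine ⟨isEntireSliceRegular_polynomial (n + 1) a, ?_⟩
  choose C hC pow_le using exists_pow_le_mul_exp_sq (half_pos hα)
  have norm_le (q : ℍ) : ‖∑ k ∈ Finset.range (n + 1), q ^ k * a k‖ ≤
      (∑ k ∈ Finset.range (n + 1), C k * ‖a k‖) *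
        ‖((exp (α / 2 * ‖q‖ ^ 2 / 2) : ℝ) : ℍ)‖ := by
    rw [Quaternion.norm_coe, norm_of_nonneg (exp_nonneg _), Finset.sum_mul]
    refine norm_sum_le_of_le _ fun k _ => ?_
    rw [norm_mul, norm_pow, mul_right_comm]
    gcongr
    exact pow_le k _ (norm_nonneg q)
  refine (fockNormPow_le_of_norm_le hp.le ?_ norm_le).trans_lt
    (ENNReal.mul_lt_top ENNReal.ofReal_lt_top (fockNormPow_exp_lt_top hp (half_lt_self hα)))
  exact Finset.sum_nonneg fun k _ => mul_nonneg (hC k) (norm_nonneg _)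

/-- The partial sums of the power series of `f`. -/
noncomputable def taylorPolynomial (f : ℍ → ℍ) (N : ℕ) (q : ℍ) : ℍ :=
  ∑ k ∈ Finset.range (N + 1), q ^ k * sliceCoeff f k

theorem taylorPolynomial_smul_mem (f : ℍ → ℍ) (N : ℕ) (r : ℝ) :
    (fun q => taylorPolynomial f N (r • q)) ∈ quaternionicPolynomials := by
  refine ⟨N, fun k => r ^ k • sliceCoeff f k, fun q => Finset.sum_congr rfl fun k _ => ?_⟩
  rw [smul_pow, smul_mul_assoc, mul_smul_comm]

theorem exists_norm_taylorPolynomial_sub_le {p α r : ℝ} (hp : 0 < p) (hα : 0 < α) {f : ℍ → ℍ}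
    (hf : f ∈ fockSpace p α) (hr₀ : 0 < r) (hr₁ : r < 1) :
    ∃ β < α, ∃ ρ ∈ Set.Ico (0 : ℝ) 1, ∃ C ≥ 0, ∀ N q,
      ‖taylorPolynomial f N (r • q) - f (r • q)‖ ≤ C * ρ ^ N * exp (β * ‖q‖ ^ 2 / 2) := by
  obtain ⟨s, hrs, hs₁⟩ := exists_between hr₁
  have hs₀ : 0 < s := hr₀.trans hrs
  obtain ⟨C, hC, coeff_le⟩ := exists_norm_sliceCoeff_mul_pow_le hp hα
    ((lt_div_iff₀ hs₀).2 (mul_lt_of_lt_one_right hα hs₁)) hf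
  have hρ : r / s < 1 := (div_lt_one hs₀).2 hrs
  have term_le (q : ℍ) (k : ℕ) :
      ‖(r • q) ^ k * sliceCoeff f k‖ ≤ C * exp (α * s * ‖q‖ ^ 2 / 2) * (r / s) ^ k := calc
    _ = ‖sliceCoeff f k‖ * (s * ‖q‖) ^ k * (r / s) ^ k := by
      rw [norm_mul, norm_pow, norm_smul, norm_of_nonneg hr₀.le, mul_assoc, ← mul_pow, mul_comm]
      congr 2
      field_simp
    _ ≤ C * exp (α / s * (s * ‖q‖) ^ 2 / 2) * (r / s) ^ k :=
      mul_le_mul_of_nonneg_right (coeff_le k _ (by positivity)) (by positivity)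
    _ = C * exp (α * s * ‖q‖ ^ 2 / 2) * (r / s) ^ k := by
      congr 3
      field_simp
  refine ⟨α * s, mul_lt_of_lt_one_right hα hs₁, r / s, ⟨by positivity, hρ⟩,
    C * (r / s) / (1 - r / s), div_nonneg (by positivity) (sub_nonneg.2 hρ.le), fun N q => ?_⟩
  have tail_le := dist_le_of_le_geometric_of_tendsto _ _ hρ
    (fun k => by simpa [Finset.sum_range_succ, dist_eq_norm] using term_le q k)
    (hasSum_sliceCoeff hf.1 (r • q)).tendsto_sum_nat (N + 1)
  rw [dist_eq_norm] at tail_le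
  refine tail_le.trans_eq ?_
  ring

theorem tendsto_fockNormPow_taylorPolynomial_sub {p α r : ℝ} (hp : 0 < p) (hα : 0 < α)
    {f : ℍ → ℍ} (hf : f ∈ fockSpace p α) (hr₀ : 0 < r) (hr₁ : r < 1) :
    Tendsto (fun N => fockNormPow p α fun q => taylorPolynomial f N (r • q) - f (r • q))
      atTop (𝓝 0) := by
  obtain ⟨β, hβα, ρ, ⟨hρ₀, hρ₁⟩, C, hC, norm_le⟩ :=
    exists_norm_taylorPolynomial_sub_le hp hα hf hr₀ hr₁
  have coefficient_tendsto : Tendsto (fun N => ENNReal.ofReal ((C * ρ ^ N) ^ p)) atTop (𝓝 0) := by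
    have := ((tendsto_pow_atTop_nhds_zero_of_lt_one hρ₀ hρ₁).const_mul C).rpow_const (.inr hp.le)
    simpa [hp.ne'] using ENNReal.tendsto_ofReal this
  refine tendsto_of_tendsto_of_tendsto_of_le_of_le tendsto_const_nhds ?_ (fun _ => zero_le)
    fun N => fockNormPow_le_of_norm_le hp.le (by positivity)
      (C := C * ρ ^ N)
      (g := fun q => (exp (β * ‖q‖ ^ 2 / 2) : ℝ)) fun q => ?_
  · simpa using ENNReal.Tendsto.mul_const coefficient_tendsto
      (.inr (fockNormPow_exp_lt_top hp hβα).ne)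
  · simpa using norm_le N q

/-- The measure `(αp/2π)² e^{-αp|q|²/2} dm(q)`, for which `‖f‖_{p,α}` is the `L^p` (quasi-)norm. -/
noncomputable def fockMeasure (p α : ℝ) : Measure ℍ :=
  ENNReal.ofReal ((α * p / (2 * π)) ^ 2) •
    volume.withDensity fun q => ENNReal.ofReal (exp (-α * ‖q‖ ^ 2 / 2) ^ p)

theorem fockNormPow_eq_lintegral {p : ℝ} (hp : 0 ≤ p) (α : ℝ) (f : ℍ → ℍ) :
    fockNormPow p α f = ∫⁻ q, ‖f q‖ₑ ^ p ∂fockMeasure p α := by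
  rw [fockNormPow, fockMeasure, lintegral_smul_measure, smul_eq_mul,
    lintegral_withDensity_eq_lintegral_mul_non_measurable _ (by fun_prop)
      (.of_forall fun _ => ENNReal.ofReal_lt_top)]
  refine congr_arg _ (lintegral_congr fun q => ?_)
  rw [ENNReal.ofReal_mul (by positivity), mul_comm,
    ← ENNReal.ofReal_rpow_of_nonneg (norm_nonneg _) hp, ofReal_norm, Pi.mul_apply]

theorem fockNormPow_sub_le {p : ℝ} (hp : 0 ≤ p) (α : ℝ) {f g : ℍ → ℍ} (h : ℍ → ℍ)
    (hf : Continuous f) (hg : Continuous g) :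
    fockNormPow p α (f - h) ≤ ENNReal.LpAddConst (ENNReal.ofReal p)⁻¹ *
      (fockNormPow p α (f - g) + fockNormPow p α (h - g)) := by
  simp only [fockNormPow_eq_lintegral hp]
  rw [← lintegral_add_left (by fun_prop),
    ← lintegral_const_mul' _ _ (ENNReal.LpAddConst_lt_top _).ne]
  refine lintegral_mono fun q => ?_
  simpa using enorm_sub_rpow_le hp (f q - g q) (h q - g q)

theorem fockNormPow_comp_smul_le {p α r : ℝ} (hp : 0 ≤ p) (hα : 0 ≤ α) (hr₀ : 0 < r) (hr₁ : r ≤ 1)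
    (f : ℍ → ℍ) :
    fockNormPow p α (fun q => f (r • q)) ≤ ENNReal.ofReal (r ^ 4)⁻¹ * fockNormPow p α f := by
  have weight_le (q : ℍ) : exp (-α * ‖q‖ ^ 2 / 2) ≤ exp (-α * ‖r • q‖ ^ 2 / 2) := by
    have : ‖r • q‖ ≤ ‖q‖ := by
      rw [norm_smul, norm_of_nonneg hr₀.le]
      exact mul_le_of_le_one_left (norm_nonneg _) hr₁
    have : α * ‖r • q‖ ^ 2 ≤ α * ‖q‖ ^ 2 := by gcongr
    gcongr exp ?_
    linarith
  have change_of_variables := lintegral_comp_smul volume hr₀.ne' fun q : ℍ =>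
    ENNReal.ofReal (‖f q‖ ^ p * exp (-α * ‖q‖ ^ 2 / 2) ^ p)
  rw [Quaternion.finrank_eq_four, abs_of_pos (by positivity)] at change_of_variables
  rw [fockNormPow, fockNormPow, mul_left_comm, ← change_of_variables]
  refine mul_le_mul_right (lintegral_mono fun q => ENNReal.ofReal_le_ofReal ?_) _
  exact mul_le_mul_of_nonneg_left (rpow_le_rpow (exp_nonneg _) (weight_le q) hp) (by positivity)

theorem tendsto_fockNormPow_sub_comp_smul {p α : ℝ} (hp : 0 < p) (hα : 0 ≤ α) {f : ℍ → ℍ}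
    (hf : Continuous f) (hf_fin : fockNormPow p α f ≠ ∞) :
    Tendsto (fun r : ℝ => fockNormPow p α fun q => f q - f (r • q)) (𝓝[<] 1) (𝓝 0) := by
  simp only [fockNormPow_eq_lintegral hp.le, enorm_sub_rev (f _) (f (_ • _))] at hf_fin ⊢
  refine tendsto_lintegral_enorm_sub_rpow hp
    (t := fun r => ENNReal.ofReal (r ^ 4)⁻¹ * ∫⁻ q, ‖f q‖ₑ ^ p ∂fockMeasure p α)
    (fun r => (hf.comp (by fun_prop)).stronglyMeasurable) hf.stronglyMeasurable hf_fin
    (.of_forall fun q => ?_) ?_ ?_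
  · have : ContinuousAt (fun r : ℝ => f (r • q)) 1 := by fun_prop
    simpa using this.tendsto.mono_left nhdsWithin_le_nhds
  · filter_upwards [Ioo_mem_nhdsLT zero_lt_one] with r hr
    simpa only [fockNormPow_eq_lintegral hp.le] using
      fockNormPow_comp_smul_le hp.le hα hr.1 hr.2.le f
  · have : ContinuousAt (fun r : ℝ => (r ^ 4)⁻¹) 1 := by fun_prop (disch := norm_num)
    simpa using ENNReal.Tendsto.mul_const
      (ENNReal.tendsto_ofReal (this.tendsto.mono_left nhdsWithin_le_nhds)) (.inr hf_fin)

theorem exists_polynomial_fockNormPow_sub_lt {p α : ℝ} (hp : 0 < p) (hα : 0 < α) {f : ℍ → ℍ}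
    (hf : f ∈ fockSpace p α) {ε : ℝ≥0∞} (hε : 0 < ε) :
    ∃ P ∈ quaternionicPolynomials, fockNormPow p α (P - f) < ε := by
  set K := ENNReal.LpAddConst (ENNReal.ofReal p)⁻¹
  have hK : K ≠ ∞ := (ENNReal.LpAddConst_lt_top _).ne
  have hf_cont : Continuous f := hf.1.1.continuous
  have dilation_error := ENNReal.Tendsto.const_mul (a := K)
    (tendsto_fockNormPow_sub_comp_smul hp hα.le hf_cont hf.2.ne) (.inr hK)
  rw [mul_zero] at dilation_error
  obtain ⟨r, dilation_lt, hr₀, hr₁⟩ :=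
    ((dilation_error.eventually_lt_const hε).and (Ioo_mem_nhdsLT zero_lt_one)).exists
  have total_error := ENNReal.Tendsto.const_mul (a := K)
    ((tendsto_fockNormPow_taylorPolynomial_sub hp hα hf hr₀ hr₁).add_const
      (fockNormPow p α fun q => f q - f (r • q))) (.inr hK)
  rw [zero_add] at total_error
  obtain ⟨N, total_lt⟩ := (total_error.eventually_lt_const dilation_lt).exists
  refine ⟨_, taylorPolynomial_smul_mem f N r, (fockNormPow_sub_le hp.le α f ?_
    (g := fun q => f (r • q)) (by fun_prop)).trans_lt total_lt⟩
  unfold taylorPolynomial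
  fun_prop

theorem exists_tendsto_fockNorm_sub {p α : ℝ} (hp : 0 < p) (hα : 0 < α) {f : ℍ → ℍ}
    (hf : f ∈ fockSpace p α) :
    ∃ P : ℕ → ℍ → ℍ, (∀ n, P n ∈ quaternionicPolynomials) ∧
      Tendsto (fun n => fockNorm p α (P n - f)) atTop (𝓝 0) := by
  obtain ⟨ε, -, hε, hε_lim⟩ := exists_seq_strictAnti_tendsto' ENNReal.zero_lt_top
  choose P hP hPf using fun n => exists_polynomial_fockNormPow_sub_lt hp hα hf (hε n).1
  refine ⟨P, hP, ?_⟩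
  have fockNormPow_tendsto : Tendsto (fun n => fockNormPow p α (P n - f)) atTop (𝓝 0) :=
    tendsto_of_tendsto_of_tendsto_of_le_of_le tendsto_const_nhds hε_lim (fun _ => zero_le)
      fun n => (hPf n).le
  simpa [fockNorm, hp] using fockNormPow_tendsto.ennrpow_const (1 / p)

end SliceFock

theorem theorem3p2 (p α : ℝ) (hp : 0 < p) (hα : 0 < α) :
    SliceFock.quaternionicPolynomials ⊆ SliceFock.fockSpace p α ∧
    ∀ f ∈ SliceFock.fockSpace p α, ∃ P : ℕ → ℍ → ℍ,
      (∀ n, P n ∈ SliceFock.quaternionicPolynomials) ∧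
      Tendsto (fun n => SliceFock.fockNorm p α (P n - f)) atTop (𝓝 0) :=
  ⟨SliceFock.quaternionicPolynomials_subset_fockSpace hp hα,
    fun _ hf => SliceFock.exists_tendsto_fockNorm_sub hp hα hf⟩
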